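/- Let $G$ be a finite simple graph that is a block graph, i.e. every block of $G$ (a maximal connected subgraph that remains connected upon the removal of any single vertex) is a complete graph. Let $\mathrm{Ind}_2(G)$ be the simplicial complex whose faces are the sets $A\subseteq V(G)$ such that every connected component of the induced subgraph $G[A]$ has at most $2$ vertices. Then $\mathrm{Ind}_2(G)$ is shellable: its facets can be ordered $F_1,\dots,F_t$ such that for each $k>1$ the complex $\langle F_k\rangle\cap\langle F_1,\dots,F_{k-1}\rangle$ is pure of dimension $\dim F_k-1$. Moreover, let $\mathrm{Con}_2(G)$ be the hypergraph with vertex set $V(G)$ whose edges are the $3$-element sets $S\subseteq V(G)$ with $G[S]$ connected. For $W\subseteq V(G)$, the contraction $\mathrm{Con}_2(G)/W$ has vertex set $V(G)\setminus W$, and its edges are the inclusion-minimal sets among the $e\setminus W$ with $e$ an edge of $\mathrm{Con}_2(G)$. A $c'$-minor of $\mathrm{Con}_2(G)$ is such a contraction that has no edge with exactly one vertex. Then every $c'$-minor of $\mathrm{Con}_2(G)$ with non-empty vertex set has a simplicial vertex, i.e. a vertex $v$ such that for any two distinct edges $e_1,e_2$ containing $v$ there is an edge $e_3\subseteq(e_1\cup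 e_2)\setminus\{v\}$. -/

import Mathlib

/-! ### Simplicial complexes and shellability

A family of finite sets that is closed under taking subsets (the empty face included) is an element
of `LowerSet (Finset V)`; the infimum of two such families is their intersection, and
`lowerClosure 𝓕` is the complex `⟨𝓕⟩` generated by the family `𝓕`. Mathlib's
`AbstractSimplicialComplex` is not used because it leaves out the empty face, which is needed as the
`(-1)`-dimensional face in the definition of a shelling. -/

/-- The facets of a complex: its faces that are maximal under inclusion. -/
def facets {V : Type*} (Δ : LowerSet (Finset V)) : Set (Finset V) :=
  {F | Maximal (fun A => A ∈ Δ) F}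

/-- The dimension of a face, `dim F = |F| - 1`. -/
def faceDim {V : Type*} (F : Finset V) : ℤ := (F.card : ℤ) - 1

/-- A complex with at least one face is pure of dimension `d` if all its facets have
dimension `d`. -/
def IsPureOfDim {V : Type*} (Δ : LowerSet (Finset V)) (d : ℤ) : Prop :=
  (Δ : Set (Finset V)).Nonempty ∧ ∀ F ∈ facets Δ, faceDim F = d

/-- (Nonpure) shellability: the facets can be listed without repetition as `F 0, …, F (t - 1)` such
that for every `k` other than the first index, `⟨F k⟩ ∩ ⟨F 0, …, F (k - 1)⟩` is pure of dimension
`dim (F k) - 1`. -/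
def IsShellable {V : Type*} (Δ : LowerSet (Finset V)) : Prop :=
  ∃ (t : ℕ) (F : Fin t → Finset V), Function.Injective F ∧ Set.range F = facets Δ ∧
    ∀ k : Fin t, 0 < (k : ℕ) →
      IsPureOfDim (lowerClosure {F k} ⊓ lowerClosure (F '' {j | j < k})) (faceDim (F k) - 1)

/-! ### The `r`-independence complex of a graph -/

/-- `A` is `r`-independent in `G` if every connected component of the induced subgraph `G[A]` has at
most `r` vertices. -/
def IsRIndependent {V : Type*} (G : SimpleGraph V) (r : ℕ) (A : Finset V) : Prop :=
  ∀ C : (G.induce (A : Set V)).ConnectedComponent, C.supp.ncard ≤ r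

theorem IsRIndependent.mono {V : Type*} {G : SimpleGraph V} {r : ℕ} {A B : Finset V} (hBA : B ⊆ A)
    (hA : IsRIndependent G r A) : IsRIndependent G r B := by
  intro C
  have hBA' : (B : Set V) ⊆ (A : Set V) := by exact_mod_cast hBA
  refine le_trans ?_ (hA (C.map (G.induceHomOfLE hBA').toHom))
  refine Set.ncard_le_ncard_of_injOn (Set.inclusion hBA') ?_
    (Set.inclusion_injective hBA').injOn (Set.toFinite _)
  intro x hx
  have hx' : (G.induce (B : Set V)).connectedComponentMk x = C := hx
  subst hx'
  rfl

/-- The `r`-independence complex `Ind_r(G)`. -/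
def rIndependenceComplex {V : Type*} (G : SimpleGraph V) (r : ℕ) : LowerSet (Finset V) where
  carrier := {A | IsRIndependent G r A}
  lower' := fun _ _ hBA hA => IsRIndependent.mono hBA hA

/-! ### Block graphs -/

/-- A connected subgraph that remains connected upon the removal of any single vertex. A single
vertex qualifies (nothing is left after its removal). -/
def IsNonseparable {V : Type*} {G : SimpleGraph V} (H : G.Subgraph) : Prop :=
  H.Connected ∧ ∀ v ∈ H.verts, (H.deleteVerts {v}).Preconnected

/-- A block is a maximal subgraph that is connected and remains so upon the removal of any single
vertex. -/
def IsBlock {V : Type*} {G : SimpleGraph V} (H : G.Subgraph) : Prop :=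
  Maximal (fun K : G.Subgraph => IsNonseparable K) H

/-- A block graph is a graph all of whose blocks are complete graphs. -/
def IsBlockGraph {V : Type*} (G : SimpleGraph V) : Prop :=
  ∀ H : G.Subgraph, IsBlock H → H.coe = ⊤

/-! ### Hypergraphs and their minors -/

/-- The hypergraph `Con_r(G)` on the vertices of `G`: its edges are the sets of `r + 1` vertices
that induce a connected subgraph of `G`. -/
def conHypergraph {V : Type*} (G : SimpleGraph V) (r : ℕ) : Hypergraph V where
  vertexSet := Set.univ
  edgeSet := {S | S.ncard = r + 1 ∧ (G.induce S).Connected}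
  subset_vertexSet_of_mem_edgeSet' := fun _ _ => Set.subset_univ _

/-- The contraction `H / W` of a set `W` of vertices of a hypergraph: the vertices in `W` are
removed, and the edges are the inclusion-minimal sets among the `e \ W`, `e` an edge of `H`. For
`W = {v}` this is the contraction of the vertex `v`. -/
def contraction {V : Type*} (H : Hypergraph V) (W : Set V) : Hypergraph V where
  vertexSet := H.vertexSet \ W
  edgeSet := {e | Minimal (fun f => f ∈ (fun g => g \ W) '' H.edgeSet) e}
  subset_vertexSet_of_mem_edgeSet' := by
    rintro e he
    obtain ⟨g, hg, rfl⟩ := he.prop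
    exact Set.sdiff_subset_sdiff_left (H.subset_vertexSet_of_mem_edgeSet hg)

/-- Contracting the vertices one after the other gives the contraction of the whole set. -/
theorem contraction_contraction {V : Type*} [Finite V] (H : Hypergraph V) (W U : Set V) :
    contraction (contraction H W) U = contraction H (W ∪ U) := by
  have key : ∀ g ∈ H.edgeSet, ∃ f ∈ (contraction H W).edgeSet, f ⊆ g \ W := by
    intro g hg
    obtain ⟨f, hf, hmin⟩ := Set.Finite.exists_le_minimal
      (Set.toFinite ((fun g => g \ W) '' H.edgeSet)) (Set.mem_image_of_mem _ hg)
    exact ⟨f, hmin, hf⟩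
  have hsub : ∀ f ∈ (contraction H W).edgeSet, ∃ g ∈ H.edgeSet, g \ W = f :=
    fun f hf => hf.prop
  apply Hypergraph.ext
  · simp only [contraction, Set.sdiff_sdiff]
  · ext e
    constructor
    · rintro ⟨⟨f, hf, rfl⟩, hmin⟩
      obtain ⟨g, hg, rfl⟩ := hsub f hf
      refine ⟨⟨g, hg, by simp only [Set.sdiff_sdiff]⟩, ?_⟩
      rintro _ ⟨g', hg', rfl⟩ hle
      obtain ⟨f', hf', hf'g⟩ := key g' hg'
      have h1 : f' \ U ⊆ g' \ (W ∪ U) := by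
        rw [← Set.sdiff_sdiff]; exact Set.sdiff_subset_sdiff_left hf'g
      exact (hmin ⟨f', hf', rfl⟩ (h1.trans hle)).trans h1
    · rintro ⟨⟨g, hg, rfl⟩, hmin⟩
      obtain ⟨f, hf, hfg⟩ := key g hg
      obtain ⟨g', hg', rfl⟩ := hsub f hf
      have h1 : (g' \ W) \ U ⊆ g \ (W ∪ U) := by
        rw [← Set.sdiff_sdiff]; exact Set.sdiff_subset_sdiff_left hfg
      have h2 : g \ (W ∪ U) ⊆ (g' \ W) \ U := by
        have := hmin ⟨g', hg', rfl⟩ (by simpa only [Set.sdiff_sdiff] using h1)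
        simpa only [Set.sdiff_sdiff] using this
      refine ⟨⟨_, hf, Set.Subset.antisymm h1 h2⟩, ?_⟩
      rintro _ ⟨f'', hf'', rfl⟩ hle
      obtain ⟨g'', hg'', rfl⟩ := hsub f'' hf''
      have := hmin ⟨g'', hg'', rfl⟩ (by simpa only [Set.sdiff_sdiff] using hle)
      simpa only [Set.sdiff_sdiff] using this

/-- `H'` is a `c'`-minor of `H` if it arises from `H` by contracting a set of vertices and has no
edge with exactly one vertex. -/
def IsCPrimeMinor {V : Type*} (H' H : Hypergraph V) : Prop :=
  (∃ W ⊆ H.vertexSet, H' = contraction H W) ∧ ∀ v, {v} ∉ H'.edgeSet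

/-- A vertex `v` of a hypergraph is simplicial if for any two (distinct) edges `e₁`, `e₂` that
contain `v` there is an edge `e₃ ⊆ (e₁ ∪ e₂) \ {v}`. -/
def IsSimplicialVertex {V : Type*} (H : Hypergraph V) (v : V) : Prop :=
  v ∈ H.vertexSet ∧ ∀ e₁ ∈ H.edgeSet, ∀ e₂ ∈ H.edgeSet, e₁ ≠ e₂ → v ∈ e₁ → v ∈ e₂ →
    ∃ e₃ ∈ H.edgeSet, e₃ ⊆ (e₁ ∪ e₂) \ {v}

/-! The only property of block graphs used is `NeighborsAdjOfReachable`: a path between two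
neighbours of `z` that avoids `z` closes up to a cycle through `z`, which lies in a single block and
hence in a clique. Faces of the complex are the sets without a path on three vertices, and edges of
the contraction by `W` are circuits relative to `W` (`IsLinkCircuit`).

Both claims rest on `NeighborsAdjOfReachable.exists_simplicial`. Suppose no single vertex outside
`W` completes a path with `W`. Root a component at a vertex outside `W` and look at the vertices
outside `W` farthest from the root. Neighbours of such a vertex that are no farther away form a
clique; farther ones lie in `W` and are pendant. So a suitable farthest vertex `v` has an almost
complete neighbourhood, and a short case analysis shows that two distinct circuits through `v` leave
a dependent set when `v` is removed.

Shellability follows by induction on the complement of `W`, for the facets containing `W`. With `v`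
simplicial, these are the facets containing `v`, together with the facets containing `W ∪ σ` for the
circuits `{v} ∪ σ`. Simpliciality makes the latter families disjoint, and allows some element of `σ`
to be exchanged for `v`, so they can be appended to the former in any order. -/

/-! ### Block graphs: cycles span cliques -/

/-- Two distinct neighbours of a vertex `z` that are joined by a walk avoiding `z` are adjacent. -/
def NeighborsAdjOfReachable {V : Type*} (G : SimpleGraph V) : Prop :=
  ∀ z x y, G.Adj z x → G.Adj z y → x ≠ y → (G.deleteIncidenceSet z).Reachable x y → G.Adj x y

namespace NeighborsAdjOfReachable

theorem deleteIncidenceSet {V : Type*} {G : SimpleGraph V} (hG : NeighborsAdjOfReachable G)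
    (u : V) : NeighborsAdjOfReachable (G.deleteIncidenceSet u) := by
  intro z x y hx hy hxy hr
  rw [SimpleGraph.deleteIncidenceSet_adj] at hx hy ⊢
  refine ⟨hG z x y hx.1 hy.1 hxy (hr.mono ?_), hx.2.2, hy.2.2⟩
  intro a b hab
  simp only [SimpleGraph.deleteIncidenceSet_adj] at hab ⊢
  exact ⟨hab.1.1, hab.2⟩

end NeighborsAdjOfReachable

theorem not_reachable_deleteIncidenceSet {V : Type*} {G : SimpleGraph V} {z x : V} (hx : x ≠ z) :
    ¬ (G.deleteIncidenceSet z).Reachable z x := by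
  rintro ⟨p⟩
  cases p with
  | nil => exact hx rfl
  | cons h _ => exact (SimpleGraph.deleteIncidenceSet_adj.1 h).2.1 rfl

theorem SimpleGraph.Subgraph.preconnected_induce_top {V : Type*} {G : SimpleGraph V} {S : Set V}
    (h : ∀ a ∈ S, ∀ b ∈ S, ∃ p : G.Walk a b, ∀ c ∈ p.support, c ∈ S) :
    ((⊤ : G.Subgraph).induce S).Preconnected := by
  rw [SimpleGraph.Subgraph.preconnected_iff_forall_exists_walk_subgraph]
  intro a b ha hb
  obtain ⟨p, hp⟩ := h a ha b hb
  exact ⟨p, p.toSubgraph_le_induce_support.trans (SimpleGraph.Subgraph.induce_mono_right hp)⟩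

theorem SimpleGraph.Walk.IsPath.eq_of_mem_takeUntil_of_mem_dropUntil {V : Type*} [DecidableEq V]
    {G : SimpleGraph V} {x y a v : V} {p : G.Walk x y} (hp : p.IsPath) (ha : a ∈ p.support)
    (h₁ : v ∈ (p.takeUntil a ha).support) (h₂ : v ∈ (p.dropUntil a ha).support) : v = a := by
  have hn := hp.support_nodup
  rw [← p.take_spec ha, SimpleGraph.Walk.support_append, List.nodup_append] at hn
  rcases SimpleGraph.Walk.mem_support_iff _ |>.1 h₂ with h | h
  · exact h
  · exact absurd rfl (hn.2.2 v h₁ v h)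

/-- A cycle through `z`, given as a path between two neighbours of `z`, spans a nonseparable
subgraph. -/
theorem isNonseparable_induce_insert_support {V : Type*} {G : SimpleGraph V} {x y z : V}
    (hx : G.Adj z x) (hy : G.Adj z y) {p : G.Walk x y} (hp : p.IsPath) (hz : z ∉ p.support) :
    IsNonseparable ((⊤ : G.Subgraph).induce (insert z {a | a ∈ p.support})) := by
  classical
  -- On the path `p`, the vertex `v` lies on at most one side of `a`; the other side leads to an end
  -- of `p`, hence to `z`.
  have to_z : ∀ v ≠ z, ∀ a ∈ p.support, a ≠ v →
      ∃ q : G.Walk a z, ∀ c ∈ q.support, c ∈ insert z {a | a ∈ p.support} \ {v} := by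
    intro v hv a ha hav
    by_cases h : v ∈ (p.takeUntil a ha).support
    · have h' : v ∉ (p.dropUntil a ha).support := fun h' =>
        hav (hp.eq_of_mem_takeUntil_of_mem_dropUntil ha h h').symm
      refine ⟨(p.dropUntil a ha).concat hy.symm, fun c hc => ?_⟩
      rw [SimpleGraph.Walk.support_concat, List.mem_append,
        List.mem_singleton] at hc
      rcases hc with hc | rfl
      · exact ⟨Or.inr (p.support_dropUntil_subset_support ha hc), fun e => h' (e ▸ hc)⟩
      · exact ⟨Or.inl rfl, hv.symm⟩
    · refine ⟨(p.takeUntil a ha).reverse.concat hx.symm, fun c hc => ?_⟩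
      rw [SimpleGraph.Walk.support_concat, List.mem_append,
        List.mem_singleton, SimpleGraph.Walk.support_reverse,
        List.mem_reverse] at hc
      rcases hc with hc | rfl
      · exact ⟨Or.inr (p.support_takeUntil_subset_support ha hc), fun e => h (e ▸ hc)⟩
      · exact ⟨Or.inl rfl, hv.symm⟩
  have del : ∀ v, ((⊤ : G.Subgraph).induce (insert z {a | a ∈ p.support} \ {v})).Preconnected := by
    intro v
    apply SimpleGraph.Subgraph.preconnected_induce_top
    by_cases hv : v = z
    · subst hv
      rintro a ⟨rfl | ha, hav⟩ b ⟨rfl | hb, hbv⟩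
      · exact absurd rfl hav
      · exact absurd rfl hav
      · exact absurd rfl hbv
      refine ⟨(p.takeUntil a ha).reverse.append (p.takeUntil b hb), fun c hc => ?_⟩
      have hc' : c ∈ p.support := by
        rw [SimpleGraph.Walk.mem_support_append_iff, SimpleGraph.Walk.support_reverse,
          List.mem_reverse] at hc
        exact hc.elim (fun h => p.support_takeUntil_subset_support ha h)
          (fun h => p.support_takeUntil_subset_support hb h)
      exact ⟨Or.inr hc', fun e => hz (e ▸ hc')⟩
    · have key : ∀ a ∈ insert z {a | a ∈ p.support} \ {v},
          ∃ q : G.Walk a z, ∀ c ∈ q.support, c ∈ insert z {a | a ∈ p.support} \ {v} := by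
        rintro a ⟨rfl | ha, hav⟩
        · exact ⟨.nil, by simpa using fun h => hav h⟩
        · exact to_z v hv a ha hav
      intro a ha b hb
      obtain ⟨q, hq⟩ := key a ha
      obtain ⟨q', hq'⟩ := key b hb
      refine ⟨q.append q'.reverse, fun c hc => ?_⟩
      rw [SimpleGraph.Walk.mem_support_append_iff, SimpleGraph.Walk.support_reverse,
        List.mem_reverse] at hc
      exact hc.elim (hq c) (hq' c)
  have whole : ∀ a ∈ insert z {a | a ∈ p.support},
      ∃ q : G.Walk a z, ∀ c ∈ q.support, c ∈ insert z {a | a ∈ p.support} := by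
    rintro a (rfl | ha)
    · exact ⟨.nil, by simp⟩
    · refine ⟨(p.takeUntil a ha).reverse.concat hx.symm, fun c hc => ?_⟩
      rw [SimpleGraph.Walk.support_concat, List.mem_append,
        List.mem_singleton, SimpleGraph.Walk.support_reverse, List.mem_reverse] at hc
      exact hc.elim (fun h => Or.inr (p.support_takeUntil_subset_support ha h)) Or.inl
  refine ⟨SimpleGraph.Subgraph.connected_iff.2
    ⟨SimpleGraph.Subgraph.preconnected_induce_top fun a ha b hb => ?_, ⟨z, Or.inl rfl⟩⟩,
    fun v _ => ?_⟩
  · obtain ⟨q, hq⟩ := whole a ha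
    obtain ⟨q', hq'⟩ := whole b hb
    refine ⟨q.append q'.reverse, fun c hc => ?_⟩
    rw [SimpleGraph.Walk.mem_support_append_iff, SimpleGraph.Walk.support_reverse,
      List.mem_reverse] at hc
    exact hc.elim (hq c) (hq' c)
  · convert del v using 1
    ext a b
    · simp [SimpleGraph.Subgraph.deleteVerts]
    · simp [SimpleGraph.Subgraph.deleteVerts]
      tauto

/-- By finiteness every nonseparable subgraph extends to a block, which is complete. -/
theorem IsBlockGraph.adj_of_isNonseparable {V : Type*} [Finite V] {G : SimpleGraph V}
    (hG : IsBlockGraph G) {K : G.Subgraph} (hK : IsNonseparable K) {x y : V} (hx : x ∈ K.verts)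
    (hy : y ∈ K.verts) (hxy : x ≠ y) : G.Adj x y := by
  obtain ⟨H, hKH, hH⟩ := Set.Finite.exists_le_maximal
    (Set.toFinite {K : G.Subgraph | IsNonseparable K}) hK
  have hadj : H.coe.Adj ⟨x, hKH.1 hx⟩ ⟨y, hKH.1 hy⟩ := by
    rw [hG H hH]
    exact fun h => hxy (congrArg Subtype.val h)
  exact H.adj_sub hadj

theorem IsBlockGraph.neighborsAdjOfReachable {V : Type*} [Finite V] {G : SimpleGraph V}
    (hG : IsBlockGraph G) : NeighborsAdjOfReachable G := by
  classical
  rintro z x y hx hy hxy ⟨q⟩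
  let p := q.bypass
  have hz : z ∉ p.support := fun h =>
    not_reachable_deleteIncidenceSet hx.ne' ⟨(p.takeUntil z h).reverse⟩
  have hle := G.deleteIncidenceSet_le z
  refine hG.adj_of_isNonseparable (isNonseparable_induce_insert_support hx hy
    (p := p.mapLe hle) ((SimpleGraph.Walk.isPath_mapLe hle).2 q.bypass_isPath) ?_)
    (Or.inr ?_) (Or.inr ?_) hxy
  · simpa using hz
  · exact SimpleGraph.Walk.start_mem_support _
  · exact SimpleGraph.Walk.end_mem_support _

/-! ### Three-vertex paths, faces and hyperedges -/

/-- No three vertices of `A` span a connected subgraph: `A` does not contain a path on three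
vertices. -/
def ThreePathFree {V : Type*} (G : SimpleGraph V) (A : Set V) : Prop :=
  ∀ ⦃a⦄, a ∈ A → ∀ ⦃b⦄, b ∈ A → ∀ ⦃c⦄, c ∈ A → G.Adj a b → G.Adj b c → a = c

theorem ThreePathFree.mono {V : Type*} {G : SimpleGraph V} {A B : Set V} (hA : ThreePathFree G A)
    (hBA : B ⊆ A) : ThreePathFree G B :=
  fun _ ha _ hb _ hc => hA (hBA ha) (hBA hb) (hBA hc)

/-- A walk never gets beyond one edge: a second step must return to the start. -/
theorem ThreePathFree.eq_or_adj_of_reachable {V : Type*} {G : SimpleGraph V} {A : Set V}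
    (hA : ThreePathFree G A) {x y : A} (h : (G.induce A).Reachable x y) :
    x = y ∨ G.Adj x y := by
  obtain ⟨p⟩ := h
  induction p with
  | nil => exact Or.inl rfl
  | @cons a b c hab _ ih =>
    have hab' : G.Adj a b := hab
    rcases ih with rfl | h
    · exact Or.inr hab'
    · exact Or.inl (Subtype.ext (hA a.2 b.2 c.2 hab' h))

theorem not_threePathFree_of_connected {V : Type*} {G : SimpleGraph V} {S : Set V}
    (hS : (G.induce S).Preconnected) (hcard : 2 < S.ncard) : ¬ ThreePathFree G S := by
  intro h
  obtain ⟨x, y, z, hx, hy, hz, hxy, hxz, hyz⟩ :=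
    (Set.two_lt_ncard_iff (Set.finite_of_ncard_pos (by omega))).1 hcard
  have key : ∀ a b (ha : a ∈ S) (hb : b ∈ S), a ≠ b → G.Adj a b := fun a b ha hb hab =>
    (h.eq_or_adj_of_reachable (hS ⟨a, ha⟩ ⟨b, hb⟩)).resolve_left
      fun e => hab (congrArg Subtype.val e)
  exact hxz (h hx hy hz (key x y hx hy hxy) (key y z hy hz hyz))

theorem connected_induce_three {V : Type*} {G : SimpleGraph V} {a b c : V} (hab : G.Adj a b)
    (hbc : G.Adj b c) : (G.induce {a, b, c}).Connected := by
  have key : ∀ x (hx : x ∈ ({a, b, c} : Set V)),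
      (G.induce {a, b, c}).Reachable ⟨x, hx⟩ ⟨b, by simp⟩ := by
    rintro x (rfl | rfl | rfl)
    · exact SimpleGraph.Adj.reachable (G := G.induce _) hab
    · exact .refl _
    · exact SimpleGraph.Adj.reachable (G := G.induce _) hbc.symm
  have : Nonempty ({a, b, c} : Set V) := ⟨⟨b, by simp⟩⟩
  exact ⟨fun x y => (key x x.2).trans (key y y.2).symm⟩

theorem mem_edgeSet_conHypergraph_two {V : Type*} {G : SimpleGraph V} {S : Set V} :
    S ∈ (conHypergraph G 2).edgeSet ↔
      ∃ a b c, S = {a, b, c} ∧ G.Adj a b ∧ G.Adj b c ∧ a ≠ c := by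
  constructor
  · rintro ⟨hcard, hconn⟩
    have h := not_threePathFree_of_connected hconn.preconnected (by omega)
    simp only [ThreePathFree, not_forall] at h
    obtain ⟨a, ha, b, hb, c, hc, hab, hbc, hac⟩ := h
    refine ⟨a, b, c, ?_, hab, hbc, hac⟩
    symm
    refine Set.eq_of_subset_of_ncard_le (by simp [Set.insert_subset_iff, *]) ?_
      (Set.finite_of_ncard_pos (by omega))
    rw [hcard, Set.ncard_eq_three.2 ⟨a, b, c, hab.ne, hac, hbc.ne, rfl⟩]
  · rintro ⟨a, b, c, rfl, hab, hbc, hac⟩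
    exact ⟨Set.ncard_eq_three.2 ⟨a, b, c, hab.ne, hac, hbc.ne, rfl⟩,
      connected_induce_three hab hbc⟩

theorem isRIndependent_two_iff {V : Type*} {G : SimpleGraph V} {A : Finset V} :
    IsRIndependent G 2 A ↔ ThreePathFree G (A : Set V) := by
  constructor
  · intro h a ha b hb c hc hab hbc
    by_contra hac
    have h2 := h ((G.induce (A : Set V)).connectedComponentMk ⟨b, hb⟩)
    refine absurd h2 (not_le.2 ((Set.two_lt_ncard_iff (Set.toFinite _)).2
      ⟨⟨a, ha⟩, ⟨b, hb⟩, ⟨c, hc⟩, ?_, ?_, ?_, ?_, ?_, ?_⟩))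
    · exact SimpleGraph.ConnectedComponent.sound
        (SimpleGraph.Adj.reachable (G := G.induce _) hab)
    · rfl
    · exact SimpleGraph.ConnectedComponent.sound
        (SimpleGraph.Adj.reachable (G := G.induce _) hbc.symm)
    · exact fun e => hab.ne (congrArg Subtype.val e)
    · exact fun e => hac (congrArg Subtype.val e)
    · exact fun e => hbc.ne (congrArg Subtype.val e)
  · intro h C
    by_contra hC
    obtain ⟨x, y, z, hx, hy, hz, hxy, hxz, hyz⟩ :=
      (Set.two_lt_ncard_iff (Set.toFinite _)).1 (not_le.1 hC)
    have key : ∀ a b, a ∈ C.supp → b ∈ C.supp → a ≠ b → G.Adj a b := fun a b ha hb hab =>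
      (h.eq_or_adj_of_reachable (C.reachable_of_mem_supp ha hb)).resolve_left hab
    exact hxz (Subtype.ext (h x.2 y.2 z.2 (key x y hx hy hxy) (key y z hy hz hyz)))

theorem threePathFree_deleteIncidenceSet_iff {V : Type*} {G : SimpleGraph V} {u : V} {A : Set V} :
    ThreePathFree (G.deleteIncidenceSet u) A ↔ ThreePathFree G (A \ {u}) := by
  simp only [ThreePathFree, SimpleGraph.deleteIncidenceSet_adj]
  constructor
  · intro h a ha b hb c hc hab hbc
    exact h ha.1 hb.1 hc.1 ⟨hab, ha.2, hb.2⟩ ⟨hbc, hb.2, hc.2⟩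
  · intro h a ha b hb c hc hab hbc
    exact h ⟨ha, hab.2.1⟩ ⟨hb, hab.2.2⟩ ⟨hc, hbc.2.2⟩ hab.1 hbc.1

/-! ### Distance layers from a root -/

theorem SimpleGraph.Reachable.dist_le_succ {V : Type*} {G : SimpleGraph V} {r a b : V}
    (h : G.Reachable r a) (hab : G.Adj a b) : G.dist r b ≤ G.dist r a + 1 := by
  obtain ⟨p, hp⟩ := h.exists_walk_length_eq_dist
  simpa [hp] using SimpleGraph.dist_le (p.concat hab)

theorem SimpleGraph.Reachable.exists_adj_dist {V : Type*} {G : SimpleGraph V} {r a : V} {n : ℕ}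
    (h : G.Reachable r a) (hn : G.dist r a = n + 1) :
    ∃ b, G.Adj a b ∧ G.Reachable r b ∧ G.dist r b = n := by
  obtain ⟨p, hp⟩ := h.symm.exists_walk_length_eq_dist
  rw [SimpleGraph.dist_comm, hn] at hp
  cases p with
  | nil => simp at hp
  | @cons _ b _ hab q =>
    have h1 : G.dist r b ≤ n := by
      have := SimpleGraph.dist_le q.reverse
      simp at this hp
      omega
    have hr : G.Reachable r b := ⟨q.reverse⟩
    have h2 := hr.dist_le_succ hab.symm
    exact ⟨b, hab, hr, by omega⟩

/-- All vertices before `a` on a geodesic from `r` are strictly closer to `r` than `z`, so the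
geodesic avoids `z`. -/
theorem SimpleGraph.Reachable.deleteIncidenceSet_of_dist_le {V : Type*} {G : SimpleGraph V}
    {r a z : V} (h : G.Reachable r a) (hle : G.dist r a ≤ G.dist r z) (haz : a ≠ z) :
    (G.deleteIncidenceSet z).Reachable r a := by
  obtain ⟨n, hn⟩ : ∃ n, G.dist r a = n := ⟨_, rfl⟩
  induction n generalizing a with
  | zero => rw [h.dist_eq_zero_iff.1 hn]
  | succ n ih =>
    obtain ⟨b, hab, hb, hbn⟩ := h.exists_adj_dist hn
    have hbz : b ≠ z := by
      rintro rfl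
      omega
    refine (ih hb (by omega) hbz hbn).trans (SimpleGraph.Adj.reachable ?_)
    exact SimpleGraph.deleteIncidenceSet_adj.2 ⟨hab.symm, hbz, haz⟩

namespace NeighborsAdjOfReachable

variable {V : Type*} {G : SimpleGraph V}

theorem adj_of_dist_le (hG : NeighborsAdjOfReachable G) {r z x y : V} (hr : G.Reachable r z)
    (hx : G.Adj z x) (hy : G.Adj z y) (hxy : x ≠ y) (hxz : G.dist r x ≤ G.dist r z)
    (hyz : G.dist r y ≤ G.dist r z) : G.Adj x y :=
  hG z x y hx hy hxy
    (((hr.trans hx.reachable).deleteIncidenceSet_of_dist_le hxz hx.ne').symm.trans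
      ((hr.trans hy.reachable).deleteIncidenceSet_of_dist_le hyz hy.ne'))

/-- A vertex has at most one neighbour that is closer to the root. -/
theorem eq_of_dist_succ (hG : NeighborsAdjOfReachable G) {r z x y : V} (hr : G.Reachable r z)
    (hx : G.Adj z x) (hy : G.Adj z y) (hxz : G.dist r x + 1 = G.dist r z)
    (hyz : G.dist r y + 1 = G.dist r z) : x = y := by
  by_contra hxy
  have hrx := hr.trans hx.reachable
  have hry := hr.trans hy.reachable
  have hadj := hG.adj_of_dist_le hr hx hy hxy (by omega) (by omega)
  obtain ⟨n, hn⟩ : ∃ n, G.dist r x = n := ⟨_, rfl⟩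
  cases n with
  | zero =>
    exact hxy ((hrx.dist_eq_zero_iff.1 hn).symm.trans (hry.dist_eq_zero_iff.1 (by omega)))
  | succ n =>
    -- The route from `z` via `y` and the root to `q` avoids `x`, so the neighbours `z` and `q` of
    -- `x` are adjacent, although their layers differ by two.
    obtain ⟨q, hxq, hrq, hq⟩ := hrx.exists_adj_dist hn
    have hzq : z ≠ q := by
      rintro rfl
      omega
    have h1 : (G.deleteIncidenceSet x).Reachable z y := SimpleGraph.Adj.reachable
      (SimpleGraph.deleteIncidenceSet_adj.2 ⟨hy, hx.ne, hadj.ne'⟩)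
    have h2 := hry.deleteIncidenceSet_of_dist_le (z := x) (by omega) (Ne.symm hxy)
    have h3 := hrq.deleteIncidenceSet_of_dist_le (z := x) (by omega) hxq.ne'
    have h4 := hG x z q hx.symm hxq hzq (h1.trans (h2.symm.trans h3))
    have h5 := hrq.dist_le_succ h4.symm
    omega

/-- If `W ∪ {u}` contains no path on three vertices for all `u ∉ W`, then there is a vertex outside
of `W` whose neighbourhood is a clique, or becomes one when a pendant neighbour in `W` is removed.
In the latter case all but one of the other neighbours have a neighbour in `W`. -/
theorem exists_neighbors_clique [Finite V] (hG : NeighborsAdjOfReachable G) {W : Set V}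
    (hW : ∀ u ∉ W, ThreePathFree G (insert u W)) (hne : ∃ u, u ∉ W) :
    ∃ v ∉ W, (∀ x y, G.Adj v x → G.Adj v y → x ≠ y → G.Adj x y) ∨
      (∃ w ∈ W, G.Adj v w ∧ ∀ x, G.Adj w x → x = v) ∧
      (∀ x y, x ∉ W → y ∉ W → G.Adj v x → G.Adj v y → x ≠ y → G.Adj x y) ∧
      ∃ p, ∀ x ∉ W, G.Adj v x → x ≠ p → ∃ w ∈ W, G.Adj x w := by
  obtain ⟨r, hr⟩ := hne
  obtain ⟨v, ⟨hvW, hrv⟩, hmax⟩ := Set.exists_max_image {v | v ∉ W ∧ G.Reachable r v} (G.dist r)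
    (Set.toFinite _) ⟨r, hr, .refl _⟩
  have hmem : ∀ x y, G.Adj x y → G.Reachable r x → G.dist r x = G.dist r v →
      G.dist r x < G.dist r y → y ∈ W := by
    intro x y hxy hrx hx hlt
    by_contra hy
    have := hmax y ⟨hy, hrx.trans hxy.reachable⟩
    omega
  -- A second neighbour `y` of `w` is not in `W`, as `x, w, y` would be a path in `W ∪ {x}`. By
  -- maximality `y` is then closer to the root than `w`, and such a neighbour is unique.
  have hpend : ∀ x w, x ∉ W → G.Adj x w → G.Reachable r x → G.dist r x = G.dist r v →
      G.dist r x < G.dist r w → ∀ y, G.Adj w y → y = x := by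
    intro x w hxW hxw hrx hx hlt y hwy
    have hw := hmem x w hxw hrx hx hlt
    by_contra hyx
    have hyW : y ∉ W := fun hy => hyx
      (hW x hxW (Or.inr hy) (Or.inr hw) (Or.inl rfl) hwy.symm hxw.symm)
    have hrw := hrx.trans hxw.reachable
    have h1 := hrx.dist_le_succ hxw
    have h2 := hmax y ⟨hyW, hrw.trans hwy.reachable⟩
    have h3 := (hrw.trans hwy.reachable).dist_le_succ hwy.symm
    exact hyx (hG.eq_of_dist_succ hrw hwy hxw.symm (by omega) (by omega))
  -- If `v` or one of its neighbours outside `W` in the top layer has no farther neighbour, that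
  -- vertex has a clique as neighbourhood and is chosen instead of `v`.
  by_cases hall : ∀ x, x ∉ W → (x = v ∨ G.Adj v x) → G.dist r x = G.dist r v →
      ∃ w, G.Adj x w ∧ G.dist r x < G.dist r w
  · refine ⟨v, hvW, Or.inr ⟨?_, ?_, ?_⟩⟩
    · obtain ⟨w, hvw, hlt⟩ := hall v hvW (Or.inl rfl) rfl
      exact ⟨w, hmem v w hvw hrv rfl hlt, hvw, hpend v w hvW hvw hrv rfl hlt⟩
    · intro x y hx hy hvx hvy hxy
      exact hG.adj_of_dist_le hrv hvx hvy hxy (hmax x ⟨hx, hrv.trans hvx.reachable⟩)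
        (hmax y ⟨hy, hrv.trans hvy.reachable⟩)
    -- The exception `p` is the neighbour of `v` towards the root; without one, every neighbour
    -- outside `W` is in the top layer and the choice of `p` is immaterial.
    · by_cases hp : ∃ p, G.Adj v p ∧ G.dist r p + 1 = G.dist r v
      · obtain ⟨p, hvp, hp⟩ := hp
        refine ⟨p, fun x hx hvx hxp => ?_⟩
        have hrx := hrv.trans hvx.reachable
        have hle := hmax x ⟨hx, hrx⟩
        have h1 := hrx.dist_le_succ hvx.symm
        have hd : G.dist r x = G.dist r v := by
          by_contra hd
          exact hxp (hG.eq_of_dist_succ hrv hvx hvp (by omega) hp)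
        obtain ⟨w, hxw, hlt⟩ := hall x hx (Or.inr hvx) hd
        exact ⟨w, hmem x w hxw hrx hd hlt, hxw⟩
      · refine ⟨v, fun x hx hvx _ => ?_⟩
        have hrx := hrv.trans hvx.reachable
        have hle := hmax x ⟨hx, hrx⟩
        have h1 := hrx.dist_le_succ hvx.symm
        have hd : G.dist r x = G.dist r v := by
          by_contra hd
          exact hp ⟨x, hvx, by omega⟩
        obtain ⟨w, hxw, hlt⟩ := hall x hx (Or.inr hvx) hd
        exact ⟨w, hmem x w hxw hrx hd hlt, hxw⟩
  · push Not at hall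
    obtain ⟨x, hxW, hvx, hx, hle⟩ := hall
    have hrx : G.Reachable r x := hvx.elim (fun h => h ▸ hrv) fun h => hrv.trans h.reachable
    exact ⟨x, hxW, Or.inl fun a b ha hb hab =>
      hG.adj_of_dist_le hrx ha hb hab (hle a ha) (hle b hb)⟩

end NeighborsAdjOfReachable

/-! ### Circuits relative to `W` and simplicial vertices -/

/-- The edges of the contraction of `W` in the hypergraph of connected triples of `G`: the minimal
sets `e` disjoint from `W` such that `W ∪ e` contains a path on three vertices. -/
structure IsLinkCircuit {V : Type*} (G : SimpleGraph V) (W e : Set V) : Prop where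
  disjoint : ∀ x ∈ e, x ∉ W
  dependent : ¬ ThreePathFree G (W ∪ e)
  free : ∀ x ∈ e, ThreePathFree G (W ∪ e \ {x})

namespace IsLinkCircuit

variable {V : Type*} {G : SimpleGraph V} {W e : Set V}

theorem eq_of_subset (he : IsLinkCircuit G W e) {f : Set V} (hfe : f ⊆ e)
    (hf : ¬ ThreePathFree G (W ∪ f)) : f = e := by
  refine hfe.antisymm fun x hx => ?_
  by_contra hxf
  exact hf ((he.free x hx).mono (Set.union_subset_union_right W
    fun y hy => ⟨hfe hy, fun h => hxf (h ▸ hy)⟩))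

theorem exists_path (he : IsLinkCircuit G W e) :
    ∃ a b c, G.Adj a b ∧ G.Adj b c ∧ a ≠ c ∧ e = {a, b, c} \ W := by
  have h := he.dependent
  simp only [ThreePathFree, not_forall] at h
  obtain ⟨a, ha, b, hb, c, hc, hab, hbc, hac⟩ := h
  refine ⟨a, b, c, hab, hbc, hac, (he.eq_of_subset ?_ fun h => hac ?_).symm⟩
  · rintro x ⟨rfl | rfl | rfl, hx⟩
    · exact ha.resolve_left hx
    · exact hb.resolve_left hx
    · exact hc.resolve_left hx
  · refine h ?_ ?_ ?_ hab hbc <;> simp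

/-- A circuit through a vertex whose neighbourhood is a clique disjoint from `W` contains a neighbour `x` of
it; either `x` has a neighbour in `W` and there are no other vertices, or there is one other
vertex. -/
theorem eq_pair_or_eq_triple (he : IsLinkCircuit G W e) {v : V} (hve : v ∈ e)
    (hv : ∀ w ∈ W, ¬ G.Adj v w)
    (hclique : ∀ x y, G.Adj v x → G.Adj v y → x ≠ y → G.Adj x y) :
    ∃ x ∈ e, G.Adj v x ∧ ((∃ w ∈ W, G.Adj x w) ∧ e = {v, x} ∨
      ∃ y ∈ e, y ≠ v ∧ G.Adj x y ∧ e = {v, x, y}) := by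
  obtain ⟨a, b, c, hab, hbc, hac, rfl⟩ := he.exists_path
  have mk : ∀ x y, G.Adj v x → G.Adj x y → v ≠ y → {a, b, c} = ({v, x, y} : Set V) →
      ∃ x ∈ {a, b, c} \ W, G.Adj v x ∧ ((∃ w ∈ W, G.Adj x w) ∧ {a, b, c} \ W = {v, x} ∨
        ∃ y ∈ {a, b, c} \ W, y ≠ v ∧ G.Adj x y ∧ {a, b, c} \ W = {v, x, y}) := by
    intro x y hvx hxy hvy heq
    rw [heq] at hve ⊢
    have hx : x ∉ W := fun h => hv x h hvx
    refine ⟨x, ⟨by simp, hx⟩, hvx, ?_⟩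
    by_cases hy : y ∈ W
    · refine Or.inl ⟨⟨y, hy, hxy⟩, ?_⟩
      ext t
      have := hve.2
      simp only [Set.mem_sdiff, Set.mem_insert_iff, Set.mem_singleton_iff]
      constructor
      · rintro ⟨rfl | rfl | rfl, h⟩ <;> tauto
      · rintro (rfl | rfl) <;> tauto
    · refine Or.inr ⟨y, ⟨by simp, hy⟩, hvy.symm, hxy, ?_⟩
      ext t
      have := hve.2
      simp only [Set.mem_sdiff, Set.mem_insert_iff, Set.mem_singleton_iff]
      constructor
      · tauto
      · rintro (rfl | rfl | rfl) <;> tauto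
  rcases hve.1 with rfl | rfl | rfl
  · exact mk b c hab hbc hac rfl
  -- With `v` in the middle, its neighbours `a` and `c` are adjacent, so the triple is also a path
  -- starting at `v`.
  · exact mk a c hab.symm (hclique a c hab.symm hbc hac) hbc.ne (by ext; simp; tauto)
  · exact mk b a hbc.symm hab.symm hac.symm (by ext; simp; tauto)

/-- A circuit through a vertex `v` with a neighbour `w` in `W` has exactly one other vertex, which is
a neighbour of `v` or `w`. -/
theorem eq_pair (he : IsLinkCircuit G W e) {v w : V} (hve : v ∈ e) (hw : w ∈ W) (hvw : G.Adj v w)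
    (hW : ∀ u ∉ W, ThreePathFree G (insert u W)) :
    ∃ x ∉ W, x ≠ v ∧ (G.Adj v x ∨ G.Adj w x) ∧ e = {v, x} := by
  have hvW := he.disjoint v hve
  have hWv : ThreePathFree G (W ∪ {v}) := Set.union_comm W {v} ▸ hW v hvW
  by_cases hx : ∃ x ∈ e, G.Adj v x
  · obtain ⟨x, hxe, hvx⟩ := hx
    have hxW := he.disjoint x hxe
    refine ⟨x, hxW, hvx.ne', Or.inl hvx, (he.eq_of_subset ?_ fun h => ?_).symm⟩
    · rintro y (rfl | rfl) <;> assumption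
    · exact hxW (h (a := x) (by simp) (b := v) (by simp) (c := w) (by simp [hw]) hvx.symm hvw ▸ hw)
  · push Not at hx
    obtain ⟨a, b, c, hab, hbc, hac, heq⟩ := he.exists_path
    have hmem : ∀ t ∈ ({a, b, c} : Set V), t ∉ W → t ∈ e := fun t ht htW => heq ▸ ⟨ht, htW⟩
    have huniq : ∀ t ∈ W, G.Adj v t → t = w := fun t ht hvt =>
      hWv (Or.inl ht) (Or.inr rfl) (Or.inl hw) hvt.symm hvw
    have hnbr : ∀ t ∈ ({a, b, c} : Set V), G.Adj v t → t = w := fun t ht hvt => by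
      by_contra htw
      by_cases htW : t ∈ W
      · exact htw (huniq t htW hvt)
      · exact hx t (hmem t ht htW) hvt
    have mk : ∀ x, G.Adj w x → x ≠ v → {a, b, c} = ({v, w, x} : Set V) →
        ∃ x ∉ W, x ≠ v ∧ (G.Adj v x ∨ G.Adj w x) ∧ e = {v, x} := by
      intro x hwx hxv hs
      have hxW : x ∉ W := fun h => hxv (hWv (Or.inl h) (Or.inl hw) (Or.inr rfl) hwx.symm hvw.symm)
      refine ⟨x, hxW, hxv, Or.inr hwx, ?_⟩
      rw [heq, hs]
      ext t
      simp only [Set.mem_sdiff, Set.mem_insert_iff, Set.mem_singleton_iff]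
      constructor
      · rintro ⟨rfl | rfl | rfl, h⟩ <;> tauto
      · rintro (rfl | rfl) <;> tauto
    have hv : v ∈ ({a, b, c} : Set V) := (heq ▸ hve).1
    rcases hv with rfl | rfl | rfl
    · obtain rfl := hnbr b (by simp) hab
      exact mk c hbc hac.symm rfl
    -- If `v` were in the middle, both ends would be its only available neighbour `w`.
    · exact absurd ((hnbr a (by simp) hab.symm).trans (hnbr c (by simp) hbc).symm) hac
    · obtain rfl := hnbr b (by simp) hbc.symm
      exact mk a hab.symm hac (by ext; simp; tauto)

end IsLinkCircuit

theorem NeighborsAdjOfReachable.exists_simplicial {V : Type*} [Finite V] {G : SimpleGraph V}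
    (hG : NeighborsAdjOfReachable G) {W : Set V} (hW : ∀ u ∉ W, ThreePathFree G (insert u W))
    (hne : ∃ u, u ∉ W) :
    ∃ v ∉ W, ∀ e₁ e₂, IsLinkCircuit G W e₁ → IsLinkCircuit G W e₂ → e₁ ≠ e₂ → v ∈ e₁ → v ∈ e₂ →
      ¬ ThreePathFree G (W ∪ (e₁ ∪ e₂) \ {v}) := by
  obtain ⟨v, hvW, hv⟩ := hG.exists_neighbors_clique hW hne
  refine ⟨v, hvW, fun e₁ e₂ he₁ he₂ hne h₁ h₂ h => ?_⟩
  by_cases hw : ∃ w ∈ W, G.Adj v w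
  · obtain ⟨w, hw, hvw⟩ := hw
    obtain ⟨x, hxW, hxv, hx, rfl⟩ := he₁.eq_pair h₁ hw hvw hW
    obtain ⟨y, hyW, hyv, hy, rfl⟩ := he₂.eq_pair h₂ hw hvw hW
    have hxy : x ≠ y := fun e => hne (e ▸ rfl)
    have hxm : x ∈ W ∪ ({v, x} ∪ {v, y}) \ {v} := by simp [hxv]
    have hym : y ∈ W ∪ ({v, x} ∪ {v, y}) \ {v} := by simp [hyv]
    -- The path is `x, w, y` if the neighbourhood of `v` is a clique. Otherwise `x` and `y` are
    -- adjacent, and whichever is not `p` continues to a vertex of `W`.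
    rcases hv with hv | ⟨⟨w', hw', hvw', hpend⟩, hclique, p, hp⟩
    · have key : ∀ x, x ∉ W → (G.Adj v x ∨ G.Adj w x) → G.Adj w x := fun x hxW hx =>
        hx.elim (fun h => hv w x hvw h fun e => hxW (e ▸ hw)) id
      exact hxy (h hxm (Or.inl hw) hym (key x hxW hx).symm (key y hyW hy))
    · obtain rfl : w = w' := hW v hvW (Or.inr hw) (Or.inl rfl) (Or.inr hw') hvw.symm hvw'
      have hvx : G.Adj v x := hx.resolve_right fun h => hxv (hpend x h)
      have hvy : G.Adj v y := hy.resolve_right fun h => hyv (hpend y h)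
      have hadj := hclique x y hxW hyW hvx hvy hxy
      by_cases hxp : x = p
      · obtain ⟨t, ht, hyt⟩ := hp y hyW hvy fun e => hxy (hxp.trans e.symm)
        exact hxW (h hxm hym (Or.inl ht) hadj hyt ▸ ht)
      · obtain ⟨t, ht, hxt⟩ := hp x hxW hvx hxp
        exact hyW (h hym hxm (Or.inl ht) hadj.symm hxt ▸ ht)
  · push Not at hw
    have hclique := hv.resolve_right fun h => by
      obtain ⟨⟨w, hwW, hvw, -⟩, -⟩ := h
      exact hw w hwW hvw
    have pair : ∀ e x, IsLinkCircuit G W e → v ∈ e → x ∈ e → G.Adj v x → (∃ w ∈ W, G.Adj x w) →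
        e = {v, x} := by
      rintro e x he hve hxe hvx ⟨w, hwW, hxw⟩
      refine (he.eq_of_subset ?_ fun h => hvW ?_).symm
      · rintro y (rfl | rfl) <;> assumption
      · exact h (a := v) (by simp) (b := x) (by simp) (c := w) (by simp [hwW]) hvx hxw ▸ hwW
    have marked : ∀ e₁ e₂ x y, IsLinkCircuit G W e₁ → IsLinkCircuit G W e₂ → e₁ ≠ e₂ → v ∈ e₁ →
        v ∈ e₂ → ThreePathFree G (W ∪ (e₁ ∪ e₂) \ {v}) → x ∈ e₁ → G.Adj v x →
        (∃ w ∈ W, G.Adj x w) → y ∈ e₂ → G.Adj v y → False := by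
      intro e₁ e₂ x y he₁ he₂ hne h₁ h₂ h hx hvx hxw hy hvy
      have heq := pair e₁ x he₁ h₁ hx hvx hxw
      have hxy : x ≠ y := by
        rintro rfl
        exact hne (heq.trans (pair e₂ x he₂ h₂ hy hvy hxw).symm)
      obtain ⟨w, hwW, hxw⟩ := hxw
      exact he₂.disjoint y hy (h (Or.inr ⟨Or.inr hy, hvy.ne'⟩) (Or.inr ⟨Or.inl hx, hvx.ne'⟩)
        (Or.inl hwW) (hclique y x hvy hvx hxy.symm) hxw ▸ hwW)
    obtain ⟨x, hx, hvx, hcases₁⟩ := he₁.eq_pair_or_eq_triple h₁ hw hclique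
    obtain ⟨x', hx', hvx', hcases₂⟩ := he₂.eq_pair_or_eq_triple h₂ hw hclique
    rcases hcases₁ with ⟨hm, -⟩ | ⟨y, hy, hyv, hxy, heq₁⟩
    · exact marked e₁ e₂ x x' he₁ he₂ hne h₁ h₂ h hx hvx hm hx' hvx'
    rcases hcases₂ with ⟨hm, -⟩ | ⟨y', hy', hyv', hxy', heq₂⟩
    · exact marked e₂ e₁ x' x he₂ he₁ hne.symm h₂ h₁ (Set.union_comm e₁ e₂ ▸ h) hx' hvx' hm hx hvx
    have mem₁ : ∀ t ∈ e₁, t ≠ v → t ∈ W ∪ (e₁ ∪ e₂) \ {v} := fun t ht htv =>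
      Or.inr ⟨Or.inl ht, htv⟩
    have mem₂ : ∀ t ∈ e₂, t ≠ v → t ∈ W ∪ (e₁ ∪ e₂) \ {v} := fun t ht htv =>
      Or.inr ⟨Or.inr ht, htv⟩
    have mx := mem₁ x hx hvx.ne'
    have my := mem₁ y hy hyv
    have mx' := mem₂ x' hx' hvx'.ne'
    have my' := mem₂ y' hy' hyv'
    -- The path is `y, x, y'` if `x = x'`. Otherwise it is `y, x, x'` or `x, x', y'`, unless both
    -- degenerate, and then the two triples coincide.
    by_cases hxx : x = x'
    · subst hxx
      have hyy := h my mx my' hxy.symm hxy'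
      exact hne (by rw [heq₁, heq₂, hyy])
    · have hadj := hclique x x' hvx hvx' hxx
      have h1 := h my mx mx' hxy.symm hadj
      have h2 := h mx mx' my' hadj hxy'
      refine hne ?_
      rw [heq₁, heq₂, h1, ← h2]
      ext
      simp
      tauto

theorem isLinkCircuit_of_mem_edgeSet {V : Type*} {G : SimpleGraph V} {W e : Set V}
    (he : e ∈ (contraction (conHypergraph G 2) W).edgeSet) : IsLinkCircuit G W e := by
  obtain ⟨⟨S, hS, rfl⟩, hmin⟩ := he
  refine ⟨fun x hx => hx.2, fun h => ?_, fun x hx => ?_⟩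
  · obtain ⟨a, b, c, rfl, hab, hbc, hac⟩ := mem_edgeSet_conHypergraph_two.1 hS
    exact hac (h (by simp) (by simp) (by simp) hab hbc)
  · intro a ha b hb c hc hab hbc
    by_contra hac
    have hsub : {a, b, c} \ W ⊆ (S \ W) \ {x} := by
      rintro t ⟨rfl | rfl | rfl, ht⟩
      · exact ha.resolve_left ht
      · exact hb.resolve_left ht
      · exact hc.resolve_left ht
    exact (hsub (hmin ⟨{a, b, c}, mem_edgeSet_conHypergraph_two.2 ⟨a, b, c, rfl, hab, hbc, hac⟩,
      rfl⟩ (hsub.trans Set.sdiff_subset) hx)).2 rfl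

/-- Thanks to this, the third edge in the definition of a simplicial vertex is obtained from mere
dependence. -/
theorem exists_mem_edgeSet_subset {V : Type*} [Finite V] {G : SimpleGraph V} {W A : Set V}
    (hA : ¬ ThreePathFree G (W ∪ A)) :
    ∃ e ∈ (contraction (conHypergraph G 2) W).edgeSet, e ⊆ A := by
  simp only [ThreePathFree, not_forall] at hA
  obtain ⟨a, ha, b, hb, c, hc, hab, hbc, hac⟩ := hA
  obtain ⟨e, he, hmin⟩ := Set.Finite.exists_le_minimal
    (Set.toFinite ((fun g => g \ W) '' (conHypergraph G 2).edgeSet))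
    (Set.mem_image_of_mem _ (mem_edgeSet_conHypergraph_two.2 ⟨a, b, c, rfl, hab, hbc, hac⟩))
  refine ⟨e, hmin, he.trans ?_⟩
  rintro t ⟨rfl | rfl | rfl, ht⟩
  · exact ha.resolve_left ht
  · exact hb.resolve_left ht
  · exact hc.resolve_left ht

theorem NeighborsAdjOfReachable.exists_isSimplicialVertex {V : Type*} [Finite V]
    {G : SimpleGraph V} (hG : NeighborsAdjOfReachable G) {H : Hypergraph V}
    (hH : IsCPrimeMinor H (conHypergraph G 2)) (hne : H.vertexSet.Nonempty) :
    ∃ v, IsSimplicialVertex H v := by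
  obtain ⟨⟨W, -, rfl⟩, hsing⟩ := hH
  obtain ⟨v, hv⟩ := hne
  by_cases hW : ThreePathFree G W
  · have hloop : ∀ u ∉ W, ThreePathFree G (insert u W) := by
      intro u _
      by_contra h
      rw [← Set.union_singleton] at h
      obtain ⟨e, he, heu⟩ := exists_mem_edgeSet_subset h
      rcases Set.subset_singleton_iff_eq.1 heu with rfl | rfl
      · exact (isLinkCircuit_of_mem_edgeSet he).dependent (by simpa using hW)
      · exact hsing u he
    obtain ⟨v, hvW, h⟩ := hG.exists_simplicial hloop ⟨v, hv.2⟩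
    refine ⟨v, ⟨trivial, hvW⟩, fun e₁ he₁ e₂ he₂ hne h₁ h₂ => exists_mem_edgeSet_subset ?_⟩
    exact h e₁ e₂ (isLinkCircuit_of_mem_edgeSet he₁) (isLinkCircuit_of_mem_edgeSet he₂) hne h₁ h₂
  -- If `W` already contains a three-vertex path, minimality leaves no nonempty edge, and every
  -- vertex is vacuously simplicial.
  · refine ⟨v, hv, fun e₁ he₁ _ _ _ h₁ _ => absurd ?_ hW⟩
    exact ((isLinkCircuit_of_mem_edgeSet he₁).free v h₁).mono Set.subset_union_left

/-! ### Shellings as exchange lists -/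

open Classical in
/-- A list of finite sets, the last one first, in which every set `F` can be exchanged against the
earlier ones: for every earlier `A` there is an earlier `B` that contains `F` up to a single element,
which is not in `A`. -/
def IsShellingList {V : Type*} : List (Finset V) → Prop
  | [] => True
  | F :: l => (∀ A ∈ l, ∃ B ∈ l, ∃ x ∈ F, x ∉ A ∧ F.erase x ⊆ B) ∧ IsShellingList l

/-- A family of sets that can be arranged in a shelling list. -/
def IsShellableFamily {V : Type*} (𝓕 : Set (Finset V)) : Prop :=
  ∃ l : List (Finset V), l.Nodup ∧ (∀ F, F ∈ l ↔ F ∈ 𝓕) ∧ IsShellingList l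

open Classical in
theorem IsShellingList.append {V : Type*} {l₁ l₂ : List (Finset V)} (h₁ : IsShellingList l₁)
    (h₂ : IsShellingList l₂)
    (h : ∀ F ∈ l₂, ∀ A ∈ l₁, ∃ B ∈ l₁, ∃ x ∈ F, x ∉ A ∧ F.erase x ⊆ B) :
    IsShellingList (l₂ ++ l₁) := by
  induction l₂ with
  | nil => exact h₁
  | cons F l ih =>
    refine ⟨fun A hA => ?_, ih h₂.2 fun F hF => h F (List.mem_cons_of_mem _ hF)⟩
    rcases List.mem_append.1 hA with hA | hA
    · obtain ⟨B, hB, hx⟩ := h₂.1 A hA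
      exact ⟨B, List.mem_append_left _ hB, hx⟩
    · obtain ⟨B, hB, hx⟩ := h F List.mem_cons_self A hA
      exact ⟨B, List.mem_append_right _ hB, hx⟩

open Classical in
theorem IsShellableFamily.union {V : Type*} {𝓐 𝓑 : Set (Finset V)} (hA : IsShellableFamily 𝓐)
    (hB : IsShellableFamily 𝓑) (hdisj : Disjoint 𝓐 𝓑)
    (h : ∀ F ∈ 𝓑, ∀ A ∈ 𝓐, ∃ B ∈ 𝓐, ∃ x ∈ F, x ∉ A ∧ F.erase x ⊆ B) :
    IsShellableFamily (𝓐 ∪ 𝓑) := by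
  obtain ⟨l₁, hn₁, hm₁, h₁⟩ := hA
  obtain ⟨l₂, hn₂, hm₂, h₂⟩ := hB
  refine ⟨l₂ ++ l₁, List.nodup_append.2 ⟨hn₂, hn₁, ?_⟩, fun F => ?_, h₁.append h₂ ?_⟩
  · rintro a ha b hb rfl
    exact Set.disjoint_left.1 hdisj ((hm₁ a).1 hb) ((hm₂ a).1 ha)
  · rw [List.mem_append, hm₁, hm₂, Set.mem_union, or_comm]
  · simpa only [hm₁, hm₂] using h

open Classical in
/-- Gluing of pairwise disjoint shellable families to a first one. -/
theorem IsShellableFamily.union_biUnion {V ι : Type*} {𝓐 : Set (Finset V)} {𝓑 : ι → Set (Finset V)}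
    (hA : IsShellableFamily 𝓐) (J : Finset ι) (hB : ∀ i ∈ J, IsShellableFamily (𝓑 i))
    (hdisj : ∀ i ∈ J, Disjoint 𝓐 (𝓑 i))
    (hdisj' : ∀ i ∈ J, ∀ j ∈ J, i ≠ j → Disjoint (𝓑 i) (𝓑 j))
    (h : ∀ i ∈ J, ∀ F ∈ 𝓑 i, ∀ A ∉ 𝓑 i, (A ∈ 𝓐 ∨ ∃ j ∈ J, A ∈ 𝓑 j) →
      ∃ B ∈ 𝓐, ∃ x ∈ F, x ∉ A ∧ F.erase x ⊆ B) :
    IsShellableFamily (𝓐 ∪ ⋃ i ∈ J, 𝓑 i) := by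
  induction J using Finset.induction_on with
  | empty => simpa using hA
  | insert i J hi ih =>
    have hd : Disjoint (𝓐 ∪ ⋃ j ∈ J, 𝓑 j) (𝓑 i) := by
      rw [Set.disjoint_union_left, Set.disjoint_iUnion₂_left]
      refine ⟨hdisj i (Finset.mem_insert_self _ _), fun j hj => ?_⟩
      refine hdisj' j (Finset.mem_insert_of_mem hj) i (Finset.mem_insert_self _ _) ?_
      rintro rfl
      exact hi hj
    have heq : 𝓐 ∪ ⋃ j ∈ insert i J, 𝓑 j = (𝓐 ∪ ⋃ j ∈ J, 𝓑 j) ∪ 𝓑 i := by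
      rw [Finset.set_biUnion_insert, Set.union_comm (𝓑 i), Set.union_assoc]
    rw [heq]
    have hJ : ∀ j ∈ J, j ∈ insert i J := fun j hj => Finset.mem_insert_of_mem hj
    refine (ih (fun j hj => hB j (hJ j hj)) (fun j hj => hdisj j (hJ j hj))
      (fun j hj k hk => hdisj' j (hJ j hj) k (hJ k hk)) fun j hj F hF A hA hA' =>
        h j (hJ j hj) F hF A hA (hA'.imp_right fun ⟨k, hk, h⟩ => ⟨k, hJ k hk, h⟩)).union
      (hB i (Finset.mem_insert_self _ _)) hd ?_
    intro F hF A hA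
    have hA' := Set.disjoint_left.1 hd hA
    simp only [Set.mem_union, Set.mem_iUnion, exists_prop] at hA
    obtain ⟨B, hB, hx⟩ := h i (Finset.mem_insert_self _ _) F hF A hA'
      (hA.imp_right fun ⟨k, hk, h⟩ => ⟨k, hJ k hk, h⟩)
    exact ⟨B, Or.inl hB, hx⟩

-- An exchange never involves the common element `u`: the exchanged `x` is missing from `A`, which
-- contains `u`.
open Classical in
theorem IsShellableFamily.image_erase {V : Type*} {𝓕 : Set (Finset V)} (h : IsShellableFamily 𝓕)
    {u : V} (hu : ∀ F ∈ 𝓕, u ∈ F) : IsShellableFamily ((fun F => F.erase u) '' 𝓕) := by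
  obtain ⟨l, hn, hm, hl⟩ := h
  have hul : ∀ F ∈ l, u ∈ F := fun F hF => hu F ((hm F).1 hF)
  refine ⟨l.map fun F => F.erase u, ?_, fun F => by simp [hm], ?_⟩
  · refine (List.nodup_map_iff_inj_on hn).2 fun F hF A hA hFA => ?_
    rw [← Finset.insert_erase (hul F hF), hFA, Finset.insert_erase (hul A hA)]
  · clear hn hm
    induction l with
    | nil => trivial
    | cons F l ih =>
      refine ⟨fun A' hA' => ?_, ih hl.2 fun F hF => hul F (List.mem_cons_of_mem _ hF)⟩
      obtain ⟨A, hA, rfl⟩ := List.mem_map.1 hA'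
      obtain ⟨B, hB, x, hxF, hxA, hx⟩ := hl.1 A hA
      have hxu : x ≠ u := by
        rintro rfl
        exact hxA (hul A (List.mem_cons_of_mem _ hA))
      refine ⟨B.erase u, List.mem_map_of_mem hB, x, Finset.mem_erase.2 ⟨hxu, hxF⟩,
        fun h => hxA (Finset.mem_of_mem_erase h), ?_⟩
      rw [Finset.erase_right_comm]
      exact Finset.erase_subset_erase u hx

open Classical in
theorem IsShellingList.exists_of_append {V : Type*} {l l₁ l₂ : List (Finset V)} {F : Finset V}
    (h : IsShellingList l) (hl : l = l₁ ++ F :: l₂) :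
    ∀ A ∈ l₂, ∃ B ∈ l₂, ∃ x ∈ F, x ∉ A ∧ F.erase x ⊆ B := by
  induction l₁ generalizing l with
  | nil => subst hl; exact h.1
  | cons A l₁ ih => subst hl; exact ih h.2 rfl

-- A common face of `F` and an earlier `A` misses the exchanged `x`, so it lies in `F.erase x`,
-- itself a common face with an earlier `B`. Hence all facets of the intersection have codimension
-- one in `F`.
open Classical in
theorem IsShellableFamily.isShellable {V : Type*} {Δ : LowerSet (Finset V)}
    (h : IsShellableFamily (facets Δ)) : IsShellable Δ := by
  obtain ⟨l, hn, hm, hl⟩ := h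
  have hm' : ∀ F, F ∈ l.reverse ↔ F ∈ facets Δ := fun F => by rw [List.mem_reverse, hm]
  refine ⟨l.reverse.length, l.reverse.get, (List.nodup_reverse.2 hn).injective_get, ?_, ?_⟩
  · ext F
    rw [← hm', List.mem_iff_get, Set.mem_range]
  · intro k hk
    have hsplit : l = (l.reverse.drop (k + 1)).reverse ++ l.reverse.get k ::
        (l.reverse.take k).reverse := by
      conv_lhs => rw [← l.reverse_reverse, ← List.take_append_drop k l.reverse,
        List.drop_eq_getElem_cons k.2]
      simp only [List.reverse_append, List.reverse_cons, List.append_assoc, List.singleton_append,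
        List.get_eq_getElem]
    have hex := hl.exists_of_append hsplit
    have htake : ∀ A, A ∈ (l.reverse.take k).reverse ↔ A ∈ l.reverse.get '' {j | j < k} := by
      intro A
      rw [List.mem_reverse, List.mem_take_iff_getElem]
      simp only [Set.mem_image, Set.mem_ofPred_eq, List.get_eq_getElem]
      constructor
      · rintro ⟨i, hi, rfl⟩
        exact ⟨⟨i, by omega⟩, Fin.lt_def.2 (by simp; omega), rfl⟩
      · rintro ⟨i, hi, rfl⟩
        exact ⟨i, by have := Fin.lt_def.1 hi; omega, rfl⟩
    simp only [htake] at hex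
    have hne : (l.reverse.get '' {j | j < k}).Nonempty :=
      ⟨_, ⟨0, hk.trans k.2⟩, Fin.lt_def.2 hk, rfl⟩
    generalize l.reverse.get '' {j | j < k} = 𝓔 at hex hne
    generalize l.reverse.get k = F at hex
    refine ⟨⟨∅, ?_, ?_⟩, fun M hM => ?_⟩
    · exact ⟨F, rfl, Finset.empty_subset F⟩
    · exact ⟨_, hne.some_mem, Finset.empty_subset _⟩
    · obtain ⟨⟨F', hF', hMF⟩, A, hA, hMA⟩ := hM.prop
      obtain rfl : F' = F := hF'
      obtain ⟨B, hB, x, hxF, hxA, hx⟩ := hex A hA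
      have hle : M ⊆ F'.erase x := fun y hy =>
        Finset.mem_erase.2 ⟨fun e => hxA (hMA (e ▸ hy)), hMF hy⟩
      have heq : M = F'.erase x := hM.eq_of_le
        ⟨⟨F', rfl, Finset.erase_subset x F'⟩, B, hB, hx⟩ hle
      rw [heq, faceDim, faceDim, Finset.card_erase_of_mem hxF,
        Nat.cast_sub (Finset.card_pos.2 ⟨x, hxF⟩)]
      simp

/-! ### Shelling the facets that contain `W` -/

theorem mem_facets_rIndependenceComplex_two {V : Type*} {G : SimpleGraph V} {F : Finset V} :
    F ∈ facets (rIndependenceComplex G 2) ↔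
      Maximal (fun A : Finset V => ThreePathFree G (A : Set V)) F := by
  have : ∀ A, A ∈ rIndependenceComplex G 2 ↔ ThreePathFree G (A : Set V) := fun A =>
    isRIndependent_two_iff
  simp only [facets, Set.mem_ofPred_eq, this]

theorem ThreePathFree.exists_facet {V : Type*} [Finite V] {G : SimpleGraph V} {A : Finset V}
    (hA : ThreePathFree G (A : Set V)) : ∃ F ∈ facets (rIndependenceComplex G 2), A ⊆ F := by
  obtain ⟨F, hAF, hF⟩ := Set.Finite.exists_le_maximal
    (Set.toFinite {A : Finset V | ThreePathFree G (A : Set V)}) hA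
  exact ⟨F, mem_facets_rIndependenceComplex_two.2 hF, hAF⟩

/-- The facets of `Ind₂(G)` that contain `W`. -/
def facetsContaining {V : Type*} (G : SimpleGraph V) (W : Finset V) : Set (Finset V) :=
  {F | F ∈ facets (rIndependenceComplex G 2) ∧ W ⊆ F}

-- No face containing `W` contains `u`. Isolating `u` turns it into a cone point, which can be added
-- to `W` and erased from the facets afterwards; the vertex type stays fixed while the complement of
-- `W` shrinks.
open Classical in
theorem facetsContaining_eq_image_erase {V : Type*} {G : SimpleGraph V} {W : Finset V} {u : V}
    (hu : u ∉ W) (hW : ¬ ThreePathFree G (insert u W : Finset V)) :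
    facetsContaining G W =
      (fun F => F.erase u) '' facetsContaining (G.deleteIncidenceSet u) (insert u W) := by
  have hnot : ∀ A : Finset V, ThreePathFree G (A : Set V) → W ⊆ A → u ∉ A := fun A hA hWA huA =>
    hW (hA.mono (Finset.coe_subset.2 (Finset.insert_subset huA hWA)))
  have hdel : ∀ A : Finset V, ThreePathFree (G.deleteIncidenceSet u) (A : Set V) ↔
      ThreePathFree G (A.erase u : Finset V) := fun A => by
    rw [threePathFree_deleteIncidenceSet_iff, Finset.coe_erase]
  ext F
  simp only [facetsContaining, mem_facets_rIndependenceComplex_two, Set.mem_image,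
    Set.mem_ofPred_eq, hdel]
  constructor
  · rintro ⟨hF, hWF⟩
    have huF := hnot F hF.prop hWF
    refine ⟨insert u F, ⟨⟨?_, fun A hA hFA => ?_⟩, Finset.insert_subset_insert u hWF⟩,
      Finset.erase_insert huF⟩
    · simpa only [Finset.erase_insert huF] using hF.prop
    · have h : F ⊆ A.erase u := fun x hx =>
        Finset.mem_erase.2 ⟨fun e => huF (e ▸ hx), hFA (Finset.mem_insert_of_mem hx)⟩
      rw [hF.eq_of_le hA h]
      exact fun x hx => by by_cases hxu : x = u <;> simp [hxu, hx]
  · rintro ⟨F, ⟨hF, hWF⟩, rfl⟩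
    have huF : u ∈ F := hWF (Finset.mem_insert_self u W)
    have hWF' : W ⊆ F.erase u := fun x hx =>
      Finset.mem_erase.2 ⟨fun e => hu (e ▸ hx), hWF (Finset.mem_insert_of_mem hx)⟩
    refine ⟨⟨hF.prop, fun A hA hFA => ?_⟩, hWF'⟩
    have huA := hnot A hA (hWF'.trans hFA)
    have h : F = insert u A := hF.eq_of_le (by simpa only [Finset.erase_insert huA] using hA)
      (fun x hx => by
        by_cases hxu : x = u
        · simp [hxu]
        · exact Finset.mem_insert_of_mem (hFA (Finset.mem_erase.2 ⟨hxu, hx⟩)))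
    rw [h, Finset.erase_insert huA]

theorem ThreePathFree.exists_isLinkCircuit {V : Type*} [Finite V] {G : SimpleGraph V} {v : V}
    {W : Set V} {A : Finset V} (hA : ThreePathFree G (A : Set V)) (hWA : W ⊆ A)
    (h : ¬ ThreePathFree G (insert v (A : Set V))) :
    ∃ e, IsLinkCircuit G W e ∧ v ∈ e ∧ e ⊆ insert v (A : Set V) := by
  have h' : ¬ ThreePathFree G (W ∪ insert v (A : Set V)) := fun hf =>
    h (hf.mono Set.subset_union_right)
  obtain ⟨e, he, hsub⟩ := exists_mem_edgeSet_subset h'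
  have hc := isLinkCircuit_of_mem_edgeSet he
  refine ⟨e, hc, ?_, hsub⟩
  by_contra hve
  exact hc.dependent (hA.mono (Set.union_subset hWA ((Set.subset_insert_iff_of_notMem hve).1 hsub)))

open Classical in
theorem NeighborsAdjOfReachable.isShellableFamily_facetsContaining {V : Type*} [Fintype V]
    {G : SimpleGraph V} (hG : NeighborsAdjOfReachable G) {W : Finset V}
    (hW : ThreePathFree G (W : Set V)) : IsShellableFamily (facetsContaining G W) := by
  obtain ⟨n, hn⟩ : ∃ n, Wᶜ.card = n := ⟨_, rfl⟩
  induction n using Nat.strong_induction_on generalizing G W with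
  | _ n ih =>
  have hlt : ∀ {U : Finset V} {u : V}, W ⊆ U → u ∈ U → u ∉ W → Uᶜ.card < n := by
    intro U u hWU huU hu
    rw [← hn]
    exact Finset.card_lt_card (compl_lt_compl_iff_lt.2 (Finset.ssubset_iff_of_subset hWU |>.2
      ⟨u, huU, hu⟩))
  by_cases hloop : ∃ u ∉ W, ¬ ThreePathFree G (insert u W : Finset V)
  · obtain ⟨u, hu, huW⟩ := hloop
    rw [facetsContaining_eq_image_erase hu huW]
    refine (ih _ (hlt (Finset.subset_insert u W) (Finset.mem_insert_self u W) hu)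
      (hG.deleteIncidenceSet u) ?_ rfl).image_erase
      fun F hF => hF.2 (Finset.mem_insert_self u W)
    rw [threePathFree_deleteIncidenceSet_iff]
    exact hW.mono (by simp)
  push Not at hloop
  by_cases hne : ∃ u, u ∉ W
  swap
  · push Not at hne
    refine ⟨[W], List.nodup_singleton W, fun F => ?_, by simp [IsShellingList]⟩
    have hmax : ∀ A : Finset V, A ⊆ W := fun A x _ => hne x
    rw [List.mem_singleton, facetsContaining, Set.mem_ofPred_eq,
      mem_facets_rIndependenceComplex_two]
    constructor
    · rintro rfl
      exact ⟨⟨hW, fun A _ _ => hmax A⟩, Finset.Subset.refl _⟩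
    · exact fun h => (hmax F).antisymm h.2
  obtain ⟨v, hvW, hv⟩ := hG.exists_simplicial (W := (W : Set V))
    (fun u hu => by simpa using hloop u hu) hne
  have hfacet : ∀ {A : Finset V}, A ∈ facets (rIndependenceComplex G 2) →
      ThreePathFree G (A : Set V) := fun hA => (mem_facets_rIndependenceComplex_two.1 hA).prop
  let J : Finset (Finset V) := {σ | v ∉ σ ∧ IsLinkCircuit G (W : Set V) (insert v (σ : Set V))}
  have hJ : ∀ {σ}, σ ∈ J ↔ v ∉ σ ∧ IsLinkCircuit G (W : Set V) (insert v (σ : Set V)) := by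
    simp [J]
  have hnotv : ∀ σ ∈ J, ∀ F ∈ facetsContaining G (W ∪ σ), v ∉ F := by
    intro σ hσ F hF hvF
    refine (hJ.1 hσ).2.dependent ((hfacet hF.1).mono ?_)
    refine Set.union_subset ?_ (Set.insert_subset hvF ?_)
    · exact Finset.coe_subset.2 (Finset.union_subset_left hF.2)
    · exact Finset.coe_subset.2 (Finset.union_subset_right hF.2)
  have hcover : facetsContaining G W =
      facetsContaining G (insert v W) ∪ ⋃ σ ∈ J, facetsContaining G (W ∪ σ) := by
    ext F
    simp only [Set.mem_union, Set.mem_iUnion, exists_prop]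
    constructor
    · intro hF
      by_cases hvF : v ∈ F
      · exact Or.inl ⟨hF.1, Finset.insert_subset hvF hF.2⟩
      · have hmax := mem_facets_rIndependenceComplex_two.1 hF.1
        obtain ⟨e, he, hve, heF⟩ := hmax.prop.exists_isLinkCircuit (v := v)
          (Finset.coe_subset.2 hF.2) fun h =>
            hvF (hmax.2 (y := insert v F) (by simpa using h) (Finset.subset_insert v F)
              (Finset.mem_insert_self v F))
        refine Or.inr ⟨e.toFinset.erase v, hJ.2 ⟨Finset.notMem_erase v _, ?_⟩, hF.1,
          Finset.union_subset hF.2 fun x hx => ?_⟩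
        · simpa [Set.insert_eq_of_mem hve] using he
        · simp only [Finset.mem_erase, Set.mem_toFinset] at hx
          exact (heF hx.2).resolve_left hx.1
    · rintro (hF | ⟨σ, -, hF⟩)
      · exact ⟨hF.1, (Finset.subset_insert v W).trans hF.2⟩
      · exact ⟨hF.1, Finset.subset_union_left.trans hF.2⟩
  rw [hcover]
  refine IsShellableFamily.union_biUnion ?_ J ?_ ?_ ?_ ?_
  · exact ih _ (hlt (Finset.subset_insert v W) (Finset.mem_insert_self v W) hvW) hG
      (hloop v hvW) rfl
  · intro σ hσ
    obtain ⟨hvσ, hc⟩ := hJ.1 hσ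
    have hfree := hc.free v (Set.mem_insert v _)
    rw [Set.insert_sdiff_self_of_notMem (by simpa using hvσ)] at hfree
    -- Adding `v` alone to `W` creates no path, so `σ` is nonempty and `W ∪ σ` is strictly larger
    -- than `W`.
    obtain ⟨x, hx⟩ : σ.Nonempty := by
      by_contra h
      rw [Finset.not_nonempty_iff_eq_empty] at h
      subst h
      exact hc.dependent (by simpa using hloop v hvW)
    exact ih _ (hlt Finset.subset_union_left (Finset.mem_union_right W hx)
      (by simpa using hc.disjoint x (Or.inr hx))) hG (by simpa using hfree) rfl
  · intro σ hσ
    rw [Set.disjoint_left]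
    exact fun F hF hF' => hnotv σ hσ F hF' (hF.2 (Finset.mem_insert_self v W))
  · intro σ hσ τ hτ hne
    rw [Set.disjoint_left]
    -- A facet containing `σ` and `τ` would contain the dependent set that simpliciality of `v`
    -- yields from the two circuits.
    intro F hF hF'
    refine hv _ _ (hJ.1 hσ).2 (hJ.1 hτ).2 (fun h => hne ?_) (Set.mem_insert v _)
      (Set.mem_insert v _) ((hfacet hF.1).mono ?_)
    · rw [← Finset.coe_insert, ← Finset.coe_insert, Finset.coe_inj] at h
      rw [← Finset.erase_insert (hJ.1 hσ).1, h, Finset.erase_insert (hJ.1 hτ).1]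
    · rintro x (hx | ⟨(rfl | hx) | (rfl | hx), hxv⟩)
      · exact hF.2 (Finset.mem_union_left _ hx)
      · exact absurd rfl hxv
      · exact hF.2 (Finset.mem_union_right _ hx)
      · exact absurd rfl hxv
      · exact hF'.2 (Finset.mem_union_right _ hx)
  · intro σ hσ F hF A hA hA'
    have hAW : A ∈ facetsContaining G W := by
      rw [hcover]
      simpa only [Set.mem_union, Set.mem_iUnion, exists_prop] using hA'
    obtain ⟨x, hxσ, hxA⟩ := Finset.not_subset.1 fun h =>
      hA ⟨hAW.1, Finset.union_subset hAW.2 h⟩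
    obtain ⟨hvσ, hc⟩ := hJ.1 hσ
    have hxW : x ∉ W := by simpa using hc.disjoint x (Or.inr hxσ)
    have hxv : x ≠ v := fun e => hvσ (e ▸ hxσ)
    have hWF : W ⊆ F.erase x := fun y hy => Finset.mem_erase.2
      ⟨fun e => hxW (e ▸ hy), hF.2 (Finset.mem_union_left _ hy)⟩
    -- Otherwise there is a circuit through `v` inside `F - x + v`. It differs from `{v} ∪ σ`, as it
    -- misses `x`, so simpliciality yields a dependent set inside the face `F`.
    have hfree : ThreePathFree G (insert v (F.erase x) : Finset V) := by
      by_contra h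
      obtain ⟨e, he, hve, heF⟩ := ThreePathFree.exists_isLinkCircuit (v := v) (A := F.erase x)
        ((hfacet hF.1).mono (Finset.coe_subset.2 (Finset.erase_subset x F)))
        (Finset.coe_subset.2 hWF) (by simpa using h)
      have heF' : ∀ y ∈ e, y ≠ v → y ∈ F.erase x := fun y hy hyv => (heF hy).resolve_left hyv
      refine hv _ e hc he (fun h => ?_) (Set.mem_insert v _) hve ((hfacet hF.1).mono ?_)
      · have hxe : x ∈ e := h ▸ Or.inr hxσ
        exact Finset.notMem_erase x F (heF' x hxe hxv)
      · rintro y (hy | ⟨(rfl | hy) | hy, hyv⟩)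
        · exact hF.2 (Finset.mem_union_left _ hy)
        · exact absurd rfl hyv
        · exact hF.2 (Finset.mem_union_right _ hy)
        · exact Finset.mem_of_mem_erase (heF' y hy hyv)
    obtain ⟨B, hB, hsub⟩ := hfree.exists_facet
    exact ⟨B, ⟨hB, (Finset.insert_subset_insert v hWF).trans hsub⟩, x,
      hF.2 (Finset.mem_union_right _ hxσ), hxA, (Finset.subset_insert v _).trans hsub⟩

theorem theorem4p7 {V : Type*} [Fintype V] (G : SimpleGraph V) (hG : IsBlockGraph G) :
    IsShellable (rIndependenceComplex G 2) ∧
      ∀ H : Hypergraph V, IsCPrimeMinor H (conHypergraph G 2) → H.vertexSet.Nonempty →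
        ∃ v, IsSimplicialVertex H v := by
  have hG' := hG.neighborsAdjOfReachable
  refine ⟨IsShellableFamily.isShellable ?_, fun H hH hne => hG'.exists_isSimplicialVertex hH hne⟩
  have h := hG'.isShellableFamily_facetsContaining (W := ∅) fun a ha => absurd ha (by simp)
  simpa [facetsContaining] using h
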